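/- Let $K$ be a nonempty compact Hausdorff space, let $C(K)$ be the space of real-valued continuous functions on $K$ with the pointwise order, and let $C(K)_+^\circ=\{f\in C(K): f(x)>0 \text{ for all } x\in K\}$. For $f,g\in C(K)_+^\circ$ put $M(f/g)=\inf\{\beta>0 : f\le \beta g\}$ and $d_H(f,g)=\log\big(M(f/g)\,M(g/f)\big)$. Let $P(C(K)_+^\circ)$ be the quotient of $C(K)_+^\circ$ obtained by identifying $f$ with $\lambda f$ for all $\lambda>0$; then $d_H$ induces a metric on $P(C(K)_+^\circ)$. Corollary. If $K_1$ and $K_2$ are nonempty compact Hausdorff spaces, then the metric spaces $(P(C(K_1)_+^\circ),d_H)$ and $(P(C(K_2)_+^\circ),d_H)$ are isometric (that is, there is a distance-preserving bijection between them) if and only if $K_1$ and $K_2$ are homeomorphic. -/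

import Mathlib

namespace HilbertGeometry

noncomputable section

/-- `M(x/y) = inf {β > 0 : x ≤ β y}`. -/
def orderRatio {X : Type*} [LE X] [SMul ℝ X] (x y : X) : ℝ :=
  sInf {β : ℝ | 0 < β ∧ x ≤ β • y}

/-- Birkhoff's version of Hilbert's metric, `d_H(x, y) = log (M(x/y) M(y/x))`. -/
def hilbertDist {X : Type*} [LE X] [SMul ℝ X] (x y : X) : ℝ :=
  Real.log (orderRatio x y * orderRatio y x)

theorem hilbertDist_comm {X : Type*} [LE X] [SMul ℝ X] (f g : X) :
    hilbertDist f g = hilbertDist g f := by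
  rw [hilbertDist, hilbertDist, mul_comm]

/-- The interior `{f : f(x) > 0 for all x ∈ K}` of the cone of nonnegative functions
in the space `C(K)` of real-valued continuous functions on `K`. -/
def PosCone (K : Type*) [TopologicalSpace K] : Type _ :=
  {f : C(K, ℝ) // ∀ x, 0 < f x}

section OrderRatio

variable {K : Type*} [TopologicalSpace K]

theorem orderRatio_le {f g : C(K, ℝ)} {c : ℝ} (hc : 0 < c) (h : f ≤ c • g) : orderRatio f g ≤ c :=
  csInf_le ⟨0, fun _ hb => hb.1.le⟩ ⟨hc, h⟩

variable [CompactSpace K] [Nonempty K]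

theorem le_orderRatio_mul (f g : PosCone K) (x : K) : f.1 x ≤ orderRatio f.1 g.1 * g.1 x := by
  rw [← div_le_iff₀ (g.2 x)]
  refine le_csInf ?_ ?_
  · obtain ⟨a, -, ha⟩ := isCompact_univ.exists_isMaxOn Set.univ_nonempty f.1.continuous.continuousOn
    obtain ⟨b, -, hb⟩ := isCompact_univ.exists_isMinOn Set.univ_nonempty g.1.continuous.continuousOn
    refine ⟨f.1 a / g.1 b, div_pos (f.2 a) (g.2 b), fun y => ?_⟩
    have h1 : f.1 y ≤ f.1 a := ha (Set.mem_univ y)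
    have h2 : g.1 b ≤ g.1 y := hb (Set.mem_univ y)
    have h3 : f.1 a = f.1 a / g.1 b * g.1 b := (div_mul_cancel₀ _ (g.2 b).ne').symm
    calc f.1 y ≤ f.1 a / g.1 b * g.1 b := h1.trans h3.le
      _ ≤ f.1 a / g.1 b * g.1 y := by
        have := div_pos (f.2 a) (g.2 b)
        gcongr
  · rintro β ⟨-, h⟩
    rw [div_le_iff₀ (g.2 x)]
    exact h x

theorem orderRatio_pos (f g : PosCone K) : 0 < orderRatio f.1 g.1 := by
  obtain ⟨x⟩ := ‹Nonempty K›
  exact pos_of_mul_pos_left ((f.2 x).trans_le (le_orderRatio_mul f g x)) (g.2 x).le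

theorem orderRatio_mul_le (f g h : PosCone K) : orderRatio f.1 h.1 ≤ orderRatio f.1 g.1 * orderRatio g.1 h.1 := by
  refine orderRatio_le (mul_pos (orderRatio_pos f g) (orderRatio_pos g h)) fun x => ?_
  have h1 := le_orderRatio_mul f g x
  have h2 := mul_le_mul_of_nonneg_left (le_orderRatio_mul g h x) (orderRatio_pos f g).le
  change f.1 x ≤ orderRatio f.1 g.1 * orderRatio g.1 h.1 * h.1 x
  linarith

theorem one_le_orderRatio_mul (f g : PosCone K) : 1 ≤ orderRatio f.1 g.1 * orderRatio g.1 f.1 := by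
  obtain ⟨x⟩ := ‹Nonempty K›
  have h1 := le_orderRatio_mul f g x
  have h2 := mul_le_mul_of_nonneg_left (le_orderRatio_mul g f x) (orderRatio_pos f g).le
  have h3 := f.2 x
  by_contra! h
  nlinarith

theorem hilbertDist_nonneg (f g : PosCone K) : 0 ≤ hilbertDist f.1 g.1 :=
  Real.log_nonneg (one_le_orderRatio_mul f g)

theorem hilbertDist_triangle (f g h : PosCone K) :
    hilbertDist f.1 h.1 ≤ hilbertDist f.1 g.1 + hilbertDist g.1 h.1 := by
  have p := orderRatio_pos (K := K)
  unfold hilbertDist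
  rw [← Real.log_mul (mul_pos (p _ _) (p _ _)).ne' (mul_pos (p _ _) (p _ _)).ne']
  refine Real.log_le_log (mul_pos (p _ _) (p _ _)) ?_
  calc orderRatio f.1 h.1 * orderRatio h.1 f.1
      ≤ (orderRatio f.1 g.1 * orderRatio g.1 h.1) * (orderRatio h.1 g.1 * orderRatio g.1 f.1) :=
        mul_le_mul (orderRatio_mul_le _ _ _) (orderRatio_mul_le _ _ _) (p _ _).le
          (mul_pos (p _ _) (p _ _)).le
    _ = _ := by ring

/-- `d_H` vanishes exactly for functions on the same ray. -/
theorem hilbertDist_eq_zero_iff (f g : PosCone K) :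
    hilbertDist f.1 g.1 = 0 ↔ ∃ c : ℝ, 0 < c ∧ f.1 = c • g.1 := by
  constructor
  · intro h
    have h1 : orderRatio f.1 g.1 * orderRatio g.1 f.1 = 1 :=
      Real.eq_one_of_pos_of_log_eq_zero (mul_pos (orderRatio_pos _ _) (orderRatio_pos _ _)) h
    refine ⟨_, orderRatio_pos f g, ContinuousMap.ext fun x => ?_⟩
    have h2 := le_orderRatio_mul f g x
    have h3 := mul_le_mul_of_nonneg_left (le_orderRatio_mul g f x) (orderRatio_pos f g).le
    rw [← mul_assoc, h1, one_mul] at h3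
    exact le_antisymm h2 h3
  · rintro ⟨c, hc, h⟩
    refine le_antisymm ?_ (hilbertDist_nonneg f g)
    have h1 : orderRatio f.1 g.1 ≤ c := orderRatio_le hc h.le
    have h2 : orderRatio g.1 f.1 ≤ c⁻¹ := by
      refine orderRatio_le (inv_pos.2 hc) ?_
      rw [h, inv_smul_smul₀ hc.ne']
    refine Real.log_nonpos (mul_pos (orderRatio_pos _ _) (orderRatio_pos _ _)).le ?_
    calc _ ≤ c * c⁻¹ := mul_le_mul h1 h2 (orderRatio_pos _ _).le hc.le
      _ = 1 := mul_inv_cancel₀ hc.ne'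

end OrderRatio

/-- Two functions are related if they lie on the same open ray from the origin. -/
def raySetoid (K : Type*) [TopologicalSpace K] : Setoid (PosCone K) where
  r f g := ∃ c : ℝ, 0 < c ∧ f.1 = c • g.1
  iseqv :=
    { refl := fun f => ⟨1, one_pos, (one_smul ℝ f.1).symm⟩
      symm := by
        rintro f g ⟨c, hc, h⟩
        exact ⟨c⁻¹, inv_pos.2 hc, by rw [h, inv_smul_smul₀ hc.ne']⟩
      trans := by
        rintro f g h ⟨c, hc, h1⟩ ⟨d, hd, h2⟩
        exact ⟨c * d, mul_pos hc hd, by rw [h1, h2, smul_smul]⟩ }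

/-- The projective space of rays in the interior of the cone of nonnegative functions. -/
def ProjPosCone (K : Type*) [TopologicalSpace K] : Type _ :=
  Quotient (raySetoid K)

/-- The metric `d_H` on the space of rays. -/
instance instMetricSpaceProjPosCone (K : Type*) [TopologicalSpace K] [CompactSpace K]
    [Nonempty K] : MetricSpace (ProjPosCone K) where
  dist := Quotient.lift₂ (fun f g : PosCone K => hilbertDist f.1 g.1) (by
    intro f g f' g' hf hg
    have hf0 := (hilbertDist_eq_zero_iff f f').2 hf
    have hg0 := (hilbertDist_eq_zero_iff g g').2 hg
    have t1 := hilbertDist_triangle f f' g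
    have t2 := hilbertDist_triangle f' g' g
    have t3 := hilbertDist_triangle f' f g'
    have t4 := hilbertDist_triangle f g g'
    have c1 := hilbertDist_comm f.1 f'.1
    have c2 := hilbertDist_comm g.1 g'.1
    change hilbertDist f.1 g.1 = hilbertDist f'.1 g'.1
    linarith)
  dist_self := by
    rintro ⟨f⟩
    exact (hilbertDist_eq_zero_iff f f).2 ⟨1, one_pos, (one_smul ℝ f.1).symm⟩
  dist_comm := by
    rintro ⟨f⟩ ⟨g⟩
    exact hilbertDist_comm f.1 g.1
  dist_triangle := by
    rintro ⟨f⟩ ⟨g⟩ ⟨h⟩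
    exact hilbertDist_triangle f g h
  eq_of_dist_eq_zero := by
    rintro ⟨f⟩ ⟨g⟩ h
    exact Quotient.sound ((hilbertDist_eq_zero_iff f g).1 h)

end

end HilbertGeometry

/-! Taking logarithms turns rays into classes of C(K) modulo constants and `d_H` into the
oscillation of log f - log g, twice the quotient norm (`exists_logEquiv`). By Mazur-Ulam an isometry
then yields a linear isometry T of these normed spaces.

The adjoint of T matches the functionals δ_x - δ_y (`exists_pairsCorrespond`), giving a bijection of
ordered pairs of distinct points. Pairs sharing a first point go to pairs sharing a coordinate
(`eq_or_eq`), and combinatorics shows that it is always the first or always the second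
(`forall_eq_or_forall_eq_swap`). In the second case T is replaced by -T. The pairs thus come from a
point map σ. Each g ∘ σ is continuous, being a preimage of g under the isometry up to a constant, so
σ is a homeomorphism. -/

namespace HilbertGeometry

noncomputable section

/-! ### The quotient norm as half the oscillation. -/

section Oscillation

/-- The real continuous functions on a compact space modulo the constant ones. The norm of a
class is half of the oscillation of its members. -/
def ModConst (K : Type*) [TopologicalSpace K] [CompactSpace K] : Type _ :=
  C(K, ℝ) ⧸ (Submodule.span ℝ {(1 : C(K, ℝ))})

variable {K : Type*} [TopologicalSpace K] [CompactSpace K]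

instance isClosed_span_one : IsClosed (Submodule.span ℝ {(1 : C(K, ℝ))} : Set C(K, ℝ)) :=
  Submodule.closed_of_finiteDimensional _

instance : NormedAddCommGroup (ModConst K) :=
  inferInstanceAs (NormedAddCommGroup (C(K, ℝ) ⧸ (Submodule.span ℝ {(1 : C(K, ℝ))})))

instance : NormedSpace ℝ (ModConst K) :=
  inferInstanceAs (NormedSpace ℝ (C(K, ℝ) ⧸ (Submodule.span ℝ {(1 : C(K, ℝ))})))

/-- The class of a function modulo the constants. -/
def ModConst.mk : C(K, ℝ) →ₗ[ℝ] ModConst K := Submodule.mkQ _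

theorem ModConst.mk_surjective : Function.Surjective (ModConst.mk (K := K)) :=
  Submodule.mkQ_surjective _

theorem ModConst.norm_mk_le (f : C(K, ℝ)) : ‖ModConst.mk f‖ ≤ ‖f‖ :=
  Submodule.Quotient.norm_mk_le _ f

theorem ModConst.norm_mk_lt (v : ModConst K) {ε : ℝ} (hε : 0 < ε) :
    ∃ f, ModConst.mk f = v ∧ ‖f‖ < ‖v‖ + ε :=
  Submodule.Quotient.norm_mk_lt v hε

theorem ModConst.mk_eq_mk_iff {f g : C(K, ℝ)} :
    ModConst.mk f = ModConst.mk g ↔ ∃ c : ℝ, ∀ x, f x = g x + c := by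
  refine (Submodule.Quotient.eq _).trans ?_
  rw [Submodule.mem_span_singleton]
  refine exists_congr fun c => ?_
  constructor
  · intro h x
    have := DFunLike.congr_fun h x
    simp only [ContinuousMap.smul_apply, ContinuousMap.one_apply, smul_eq_mul, mul_one,
      ContinuousMap.sub_apply] at this
    linarith
  · intro h
    ext x
    simp [h x]

theorem sub_le_two_mul_norm_mk (f : C(K, ℝ)) (x y : K) : f x - f y ≤ 2 * ‖ModConst.mk f‖ := by
  refine le_of_forall_pos_le_add fun ε hε => ?_
  obtain ⟨g, hg, hgn⟩ := ModConst.norm_mk_lt (ModConst.mk f) (half_pos hε)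
  obtain ⟨c, hc⟩ := ModConst.mk_eq_mk_iff.1 hg
  have hx := (abs_le.1 (g.norm_coe_le_norm x)).2
  have hy := (abs_le.1 (g.norm_coe_le_norm y)).1
  have := hc x
  have := hc y
  linarith

theorem norm_mk_eq_of_forall_sub_le {f : C(K, ℝ)} {x y : K}
    (h : ∀ a b, f a - f b ≤ f x - f y) : f x - f y = 2 * ‖ModConst.mk f‖ := by
  refine le_antisymm (sub_le_two_mul_norm_mk f x y) ?_
  have h0 : 0 ≤ f x - f y := by simpa using h x x
  -- Subtracting the midrange gives the representative of least sup norm.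
  have hmk : ModConst.mk f = ModConst.mk (f - ContinuousMap.const K ((f x + f y) / 2)) :=
    ModConst.mk_eq_mk_iff.2 ⟨(f x + f y) / 2, fun z => by simp⟩
  have hle : ‖f - ContinuousMap.const K ((f x + f y) / 2)‖ ≤ (f x - f y) / 2 := by
    refine (ContinuousMap.norm_le _ (by linarith)).2 fun z => ?_
    rw [Real.norm_eq_abs, abs_le]
    have h1 := h z y
    have h2 := h x z
    simp only [ContinuousMap.sub_apply, ContinuousMap.const_apply]
    constructor <;> linarith
  have := (ModConst.norm_mk_le _).trans hle
  rw [hmk]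
  linarith

theorem exists_forall_sub_le [Nonempty K] (f : C(K, ℝ)) :
    ∃ x y, ∀ a b, f a - f b ≤ f x - f y := by
  obtain ⟨x, -, hx⟩ := isCompact_univ.exists_isMaxOn Set.univ_nonempty f.continuous.continuousOn
  obtain ⟨y, -, hy⟩ := isCompact_univ.exists_isMinOn Set.univ_nonempty f.continuous.continuousOn
  exact ⟨x, y, fun a b => sub_le_sub (hx (Set.mem_univ a)) (hy (Set.mem_univ b))⟩

end Oscillation

/-! ### Logarithmic coordinates for Hilbert's metric. -/

section Log

variable {K : Type*} [TopologicalSpace K]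

/-- The pointwise logarithm of a positive function. -/
def PosCone.log (f : PosCone K) : C(K, ℝ) :=
  ⟨fun x => Real.log (f.1 x), f.1.continuous.log fun x => (f.2 x).ne'⟩

@[simp]
theorem PosCone.log_apply (f : PosCone K) (x : K) : f.log x = Real.log (f.1 x) := rfl

variable [CompactSpace K] [Nonempty K]

theorem orderRatio_eq_div (f g : PosCone K) {x : K}
    (h : ∀ a, f.log a - g.log a ≤ f.log x - g.log x) : orderRatio f.1 g.1 = f.1 x / g.1 x := by
  refine le_antisymm (orderRatio_le (div_pos (f.2 x) (g.2 x)) fun a => ?_)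
    ((div_le_iff₀ (g.2 x)).2 (le_orderRatio_mul f g x))
  have ha := h a
  simp only [PosCone.log_apply] at ha
  rw [← Real.log_div (f.2 a).ne' (g.2 a).ne', ← Real.log_div (f.2 x).ne' (g.2 x).ne',
    Real.log_le_log_iff (div_pos (f.2 a) (g.2 a)) (div_pos (f.2 x) (g.2 x)),
    div_le_iff₀ (g.2 a)] at ha
  exact ha

/-- The two order ratios are the exponentials of the maximum of log f - log g and of minus its
minimum. -/
theorem hilbertDist_eq_two_mul_norm (f g : PosCone K) :
    hilbertDist f.1 g.1 = 2 * ‖ModConst.mk f.log - ModConst.mk g.log‖ := by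
  obtain ⟨x, y, h⟩ := exists_forall_sub_le (f.log - g.log)
  have hn := norm_mk_eq_of_forall_sub_le h
  rw [map_sub] at hn
  have h1 : orderRatio f.1 g.1 = f.1 x / g.1 x :=
    orderRatio_eq_div f g fun a => by simpa using h a y
  have h2 : orderRatio g.1 f.1 = g.1 y / f.1 y :=
    orderRatio_eq_div g f fun a => by
      have := h x a
      simp only [ContinuousMap.sub_apply] at this
      linarith
  rw [← hn, hilbertDist, h1, h2,
    Real.log_mul (div_pos (f.2 x) (g.2 x)).ne' (div_pos (g.2 y) (f.2 y)).ne',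
    Real.log_div (f.2 x).ne' (g.2 x).ne', Real.log_div (g.2 y).ne' (f.2 y).ne']
  simp only [ContinuousMap.sub_apply, PosCone.log_apply]
  ring

theorem exists_logEquiv (K : Type*) [TopologicalSpace K] [CompactSpace K] [Nonempty K] :
    ∃ L : ProjPosCone K ≃ ModConst K, ∀ p q, dist p q = 2 * dist (L p) (L q) := by
  let L : ProjPosCone K → ModConst K :=
    Quotient.lift (fun f : PosCone K => ModConst.mk f.log) (by
      intro f g hfg
      have h0 := (hilbertDist_eq_zero_iff f g).2 hfg
      rw [hilbertDist_eq_two_mul_norm] at h0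
      exact sub_eq_zero.1 (norm_eq_zero.1 (by linarith)))
  have hL : ∀ p q, dist p q = 2 * dist (L p) (L q) := by
    rintro ⟨f⟩ ⟨g⟩
    rw [dist_eq_norm]
    exact hilbertDist_eq_two_mul_norm f g
  refine ⟨Equiv.ofBijective L ⟨fun p q h => ?_, fun v => ?_⟩, hL⟩
  · rw [← dist_eq_zero, hL, h, dist_self, mul_zero]
  · obtain ⟨f, rfl⟩ := ModConst.mk_surjective v
    refine ⟨Quotient.mk _ ⟨⟨fun x => Real.exp (f x), by fun_prop⟩, fun x => Real.exp_pos _⟩, ?_⟩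
    refine congrArg ModConst.mk (ContinuousMap.ext fun x => ?_)
    exact Real.log_exp _

end Log

/-! ### From linear isometries to homeomorphisms. -/

section LinearIsometry

variable {K₁ K₂ : Type*} [TopologicalSpace K₁] [CompactSpace K₁]
  [TopologicalSpace K₂] [CompactSpace K₂]

/-- A continuous function takes its values modulo constants at two points as a difference of
functions attaining their oscillation at these points. -/
theorem exists_add_forall_sub_le [T2Space K₁] {x y : K₁} (hxy : x ≠ y) (f : C(K₁, ℝ)) :
    ∃ h : C(K₁, ℝ), (∀ a b, h a - h b ≤ h x - h y) ∧
      ∀ a b, (f + h) a - (f + h) b ≤ (f + h) x - (f + h) y := by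
  obtain ⟨u, hu0, hu1, hu⟩ := exists_continuous_zero_one_of_isClosed
    (isClosed_singleton (x := y)) (isClosed_singleton (x := x)) (by simpa using hxy.symm)
  have hux : u x = 1 := hu1 rfl
  have huy : u y = 0 := hu0 rfl
  set D := ‖f‖
  have hf : ∀ z, -D ≤ f z ∧ f z ≤ D := fun z => abs_le.1 (f.norm_coe_le_norm z)
  have hD : 0 ≤ D := norm_nonneg f
  -- A peak at x and a trough at y; the absolute values absorb the variation of f near these points.
  -- The factor 10 is only ample: 2 would suffice.
  let h : C(K₁, ℝ) :=
    ⟨fun z => u z * (10 * D - |f z - f x|) + (1 - u z) * (|f z - f y| - 10 * D), by fun_prop⟩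
  have hz : ∀ z, h z = u z * (10 * D - |f z - f x|) + (1 - u z) * (|f z - f y| - 10 * D) :=
    fun _ => rfl
  have hx : h x = 10 * D := by simp [hz, hux]
  have hy : h y = -(10 * D) := by simp [hz, huy]
  have bound : ∀ z, h y ≤ h z ∧ h z ≤ h x ∧ f y + h y ≤ f z + h z ∧ f z + h z ≤ f x + h x := by
    intro z
    obtain ⟨u0, u1⟩ := hu z
    have v0 : 0 ≤ 1 - u z := by linarith
    have := hf x
    have := hf y
    have := hf z
    have p0 := abs_nonneg (f z - f x)
    have q0 := abs_nonneg (f z - f y)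
    have p1 := le_abs_self (f z - f x)
    have q1 := neg_abs_le (f z - f y)
    have p2 : |f z - f x| ≤ 2 * D := abs_le.2 ⟨by linarith, by linarith⟩
    have q2 : |f z - f y| ≤ 2 * D := abs_le.2 ⟨by linarith, by linarith⟩
    rw [hx, hy, hz]
    refine ⟨?_, ?_, ?_, ?_⟩
    · linarith [mul_nonneg u0 (show 0 ≤ 20 * D - |f z - f x| by linarith), mul_nonneg v0 q0]
    · linarith [mul_nonneg u0 p0, mul_nonneg v0 (show 0 ≤ 20 * D - |f z - f y| by linarith)]
    · linarith [mul_nonneg u0 (show 0 ≤ 20 * D - |f z - f x| + f z - f y by linarith),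
        mul_nonneg v0 (show 0 ≤ |f z - f y| + f z - f y by linarith)]
    · linarith [mul_nonneg u0 (show 0 ≤ |f z - f x| + f x - f z by linarith),
        mul_nonneg v0 (show 0 ≤ 20 * D - |f z - f y| + f x - f z by linarith)]
  refine ⟨h, fun a b => ?_, fun a b => ?_⟩
  · linarith [(bound a).2.1, (bound b).1]
  · simp only [ContinuousMap.add_apply]
    linarith [(bound a).2.2.2, (bound b).2.2.1]

/-- The adjoint of `T` sends `δ_p - δ_q` to `δ_x - δ_y`. -/
def PairsCorrespond (T : ModConst K₁ ≃ₗᵢ[ℝ] ModConst K₂) (x y : K₁) (p q : K₂) : Prop :=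
  ∀ f g, T (ModConst.mk f) = ModConst.mk g → g p - g q = f x - f y

/-- Among functions with maximum at x and minimum at y, oscillation is additive. T preserves it, so
finitely many images attain their oscillations at one common pair, and compactness gives a pair for
all of them. Differences of such functions exhaust C(K₁). -/
theorem exists_pairsCorrespond [T2Space K₁] [Nonempty K₂] (T : ModConst K₁ ≃ₗᵢ[ℝ] ModConst K₂) {x y : K₁}
    (hxy : x ≠ y) : ∃ p q, p ≠ q ∧ PairsCorrespond T x y p q := by
  let I := {i : C(K₁, ℝ) × C(K₂, ℝ) //
    T (ModConst.mk i.1) = ModConst.mk i.2 ∧ ∀ a b, i.1 a - i.1 b ≤ i.1 x - i.1 y}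
  let Z : I → Set (K₂ × K₂) := fun i => {z | i.1.2 z.1 - i.1.2 z.2 = 2 * ‖ModConst.mk i.1.2‖}
  have hne : (⋂ i, Z i).Nonempty := by
    refine CompactSpace.iInter_nonempty (fun i => isClosed_eq (by fun_prop) (by fun_prop))
      fun s => ?_
    obtain ⟨p, q, hpq⟩ := exists_forall_sub_le (∑ i ∈ s, i.1.2)
    have h2 := norm_mk_eq_of_forall_sub_le hpq
    have hT : T (ModConst.mk (∑ i ∈ s, i.1.1)) = ModConst.mk (∑ i ∈ s, i.1.2) := by
      rw [map_sum, map_sum, map_sum]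
      exact Finset.sum_congr rfl fun i _ => i.2.1
    have h1 : ∀ a b, (∑ i ∈ s, i.1.1) a - (∑ i ∈ s, i.1.1) b ≤
        (∑ i ∈ s, i.1.1) x - (∑ i ∈ s, i.1.1) y := fun a b => by
      simp only [ContinuousMap.sum_apply, ← Finset.sum_sub_distrib]
      exact Finset.sum_le_sum fun i _ => i.2.2 a b
    replace h1 := norm_mk_eq_of_forall_sub_le h1
    rw [← hT, T.norm_map, ← h1] at h2
    simp only [ContinuousMap.sum_apply, ← Finset.sum_sub_distrib] at h2
    have hle : ∀ i ∈ s, i.1.2 p - i.1.2 q ≤ i.1.1 x - i.1.1 y := fun i _ => by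
      rw [norm_mk_eq_of_forall_sub_le i.2.2, ← T.norm_map, i.2.1]
      exact sub_le_two_mul_norm_mk _ _ _
    refine ⟨(p, q), Set.mem_iInter₂.2 fun i hi => ?_⟩
    change i.1.2 p - i.1.2 q = 2 * ‖ModConst.mk i.1.2‖
    rw [← i.2.1, T.norm_map, ← norm_mk_eq_of_forall_sub_le i.2.2]
    -- Termwise inequalities whose sums agree are equalities.
    exact (Finset.sum_eq_sum_iff_of_le hle).1 h2 i hi
  obtain ⟨⟨p, q⟩, hz⟩ := hne
  have key : ∀ f g, T (ModConst.mk f) = ModConst.mk g → (∀ a b, f a - f b ≤ f x - f y) →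
      g p - g q = f x - f y := fun f g hfg hf => by
    have := Set.mem_iInter.1 hz ⟨(f, g), hfg, hf⟩
    change g p - g q = 2 * ‖ModConst.mk g‖ at this
    rw [this, ← hfg, T.norm_map, norm_mk_eq_of_forall_sub_le hf]
  have hR : PairsCorrespond T x y p q := fun f g hfg => by
    obtain ⟨h, h1, h2⟩ := exists_add_forall_sub_le hxy f
    obtain ⟨k, hk⟩ := ModConst.mk_surjective (T (ModConst.mk h))
    have e1 := key h k hk.symm h1
    have e2 := key (f + h) (g + k) (by rw [map_add, map_add, map_add, hfg, hk]) h2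
    simp only [ContinuousMap.add_apply] at e2
    linarith
  refine ⟨p, q, ?_, hR⟩
  rintro rfl
  obtain ⟨u, hu0, hu1, -⟩ := exists_continuous_zero_one_of_isClosed
    (isClosed_singleton (x := y)) (isClosed_singleton (x := x)) (by simpa using hxy.symm)
  obtain ⟨k, hk⟩ := ModConst.mk_surjective (T (ModConst.mk u))
  have := hR u k hk.symm
  rw [hu0 rfl, hu1 rfl] at this
  simp at this

namespace PairsCorrespond

variable {T : ModConst K₁ ≃ₗᵢ[ℝ] ModConst K₂}

theorem swap {x y : K₁} {p q : K₂} (h : PairsCorrespond T x y p q) :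
    PairsCorrespond T y x q p := fun f g hfg => by
  linarith [h f g hfg]

theorem symm {x y : K₁} {p q : K₂} (h : PairsCorrespond T x y p q) :
    PairsCorrespond T.symm p q x y := fun f g hfg =>
  (h g f (by rw [← hfg, T.apply_symm_apply])).symm

theorem neg {x y : K₁} {p q : K₂} (h : PairsCorrespond T x y p q) :
    PairsCorrespond (T.trans (LinearIsometryEquiv.neg ℝ)) x y q p := fun f g hfg => by
  have := h f (-g) (by
    rw [map_neg, ← hfg]
    simp)
  simp only [ContinuousMap.neg_apply] at this
  linarith

/-- If x ≠ x', a nonnegative f with f x = 1 that vanishes at y and x' would give 1 = -f y' ≤ 0;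
likewise for y. -/
theorem unique_left [T2Space K₁] {x y x' y' : K₁} {p q : K₂} (h : PairsCorrespond T x y p q)
    (h' : PairsCorrespond T x' y' p q) (hxy : x ≠ y) : x = x' ∧ y = y' := by
  have key : ∀ f : C(K₁, ℝ), f x - f y = f x' - f y' := fun f => by
    obtain ⟨k, hk⟩ := ModConst.mk_surjective (T (ModConst.mk f))
    rw [← h f k hk.symm, h' f k hk.symm]
  have sep : ∀ a b c : K₁, a ≠ b → a ≠ c → ∃ f : C(K₁, ℝ), f b = 0 ∧ f c = 0 ∧ f a = 1 ∧
      ∀ z, 0 ≤ f z := fun a b c hb hc => by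
    obtain ⟨u, hu0, hu1, hu⟩ := exists_continuous_zero_one_of_isClosed
      (Set.toFinite {b, c}).isClosed (isClosed_singleton (x := a)) (by simp [hb, hc])
    exact ⟨u, hu0 (by simp), hu0 (by simp), hu1 rfl, fun z => (hu z).1⟩
  constructor
  · by_contra hne
    obtain ⟨f, h1, h2, h3, h4⟩ := sep x y x' hxy hne
    linarith [key f, h4 y']
  · by_contra hne
    obtain ⟨f, h1, h2, h3, h4⟩ := sep y x y' hxy.symm hne
    linarith [key f, h4 x']

theorem unique_right [T2Space K₂] {x y : K₁} {p q p' q' : K₂} (h : PairsCorrespond T x y p q)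
    (h' : PairsCorrespond T x y p' q') (hpq : p ≠ q) : p = p' ∧ q = q' :=
  (h.symm).unique_left h'.symm hpq

/-- Two pairs with a common first point correspond to pairs with a common first or second point. -/
theorem eq_or_eq [T2Space K₂] {x y z : K₁} {p q r s : K₂} (h : PairsCorrespond T x y p q)
    (h' : PairsCorrespond T x z r s) (hpq : p ≠ q) (hrs : r ≠ s) : p = r ∨ q = s := by
  by_contra! hne
  obtain ⟨hpr, hqs⟩ := hne
  -- The preimage g of this f has g x - g y = 1 and g x - g z = -1, so oscillation at least 2,
  -- whereas f oscillates by at most 1.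
  obtain ⟨f, hf0, hf1, hf⟩ := exists_continuous_zero_one_of_isClosed
    (Set.toFinite {q, r}).isClosed (Set.toFinite {p, s}).isClosed
    (by simp [hpq, hrs.symm, hpr, hqs.symm])
  obtain ⟨g, hg⟩ := ModConst.mk_surjective (T.symm (ModConst.mk f))
  have hgf : T (ModConst.mk g) = ModConst.mk f := by rw [hg, T.apply_symm_apply]
  have : Nonempty K₂ := ⟨p⟩
  obtain ⟨a, b, hab⟩ := exists_forall_sub_le f
  have e1 := h g f hgf
  have e2 := h' g f hgf
  have e3 := sub_le_two_mul_norm_mk g z y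
  rw [← T.norm_map, hgf, ← norm_mk_eq_of_forall_sub_le hab] at e3
  have fp : f p = 1 := hf1 (by simp)
  have fs : f s = 1 := hf1 (by simp)
  have fq : f q = 0 := hf0 (by simp)
  have fr : f r = 0 := hf0 (by simp)
  linarith [(hf a).2, (hf b).1]

end PairsCorrespond

/-- If a map between ordered pairs of distinct points commutes with exchanging the points, and
sends pairs with a common first point to pairs with a common coordinate, then this is always
the first coordinate or always the second one. -/
theorem forall_eq_or_forall_eq_swap {α β : Type*} {P : α → α → β}
    (hne : ∀ x y, x ≠ y → P x y ≠ P y x)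
    (hor : ∀ x y z, x ≠ y → x ≠ z → P x y = P x z ∨ P y x = P z x) :
    (∀ x y z, x ≠ y → x ≠ z → P x y = P x z) ∨ ∀ x y z, x ≠ y → x ≠ z → P y x = P z x := by
  -- If the first coordinate varies over the pairs starting at x, the second is constant over all of
  -- them.
  have line : ∀ x y z, x ≠ y → x ≠ z → P x y ≠ P x z → ∀ w, x ≠ w → P w x = P y x := by
    intro x y z hy hz h w hw
    have hyz : P y x = P z x := (hor x y z hy hz).resolve_left h
    by_contra hwy
    have h1 : P x w = P x y := (hor x w y hw hy).resolve_right hwy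
    have h2 : P x w = P x z := (hor x w z hw hz).resolve_right (hyz ▸ hwy)
    exact h (h1.symm.trans h2)
  by_contra! hcon
  obtain ⟨⟨x, y, z, hy, hz, h⟩, x', y', z', hy', hz', h'⟩ := hcon
  have hx := line x y z hy hz h
  have hfst : P x' y' = P x' z' := (hor x' y' z' hy' hz').resolve_right h'
  have hx' : ∀ w, x' ≠ w → P x' w = P x' y' := by
    intro w hw
    by_contra hwy
    have h1 : P w x' = P y' x' := (hor x' w y' hw hy').resolve_left hwy
    have h2 : P w x' = P z' x' := (hor x' w z' hw hz').resolve_left (hfst ▸ hwy)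
    exact h' (h1.symm.trans h2)
  have hxx' : x ≠ x' := by
    rintro rfl
    exact h ((hx' y hy).trans (hx' z hz).symm)
  -- Since y ≠ z, one of them differs from x'. The pairs at w then clash with both the type of x and
  -- that of x'.
  obtain ⟨w, hxw, hxw'⟩ : ∃ w, x ≠ w ∧ x' ≠ w := by
    by_cases hyx : x' = y
    · exact ⟨z, hz, fun e => h (by rw [← hyx, ← e])⟩
    · exact ⟨y, hy, hyx⟩
  have e1 : P w x = P x' w := by rw [hx w hxw, ← hx x' hxx', hx' x hxx'.symm, hx' w hxw']
  rcases hor w x x' hxw.symm hxw'.symm with e | e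
  · exact hne w x' hxw'.symm (e ▸ e1)
  · exact hne w x hxw.symm (e1.trans e.symm)

theorem exists_forall_pairsCorrespond [T2Space K₁] [T2Space K₂] [Nonempty K₂]
    (T : ModConst K₁ ≃ₗᵢ[ℝ] ModConst K₂) :
    ∃ (S : ModConst K₁ ≃ₗᵢ[ℝ] ModConst K₂) (σ : K₁ → K₂),
      ∀ x y, x ≠ y → σ x ≠ σ y ∧ PairsCorrespond S x y (σ x) (σ y) := by
  have hex : ∀ x y : K₁, ∃ p q, x ≠ y → p ≠ q ∧ PairsCorrespond T x y p q := fun x y => by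
    by_cases hxy : x = y
    · exact ⟨Classical.arbitrary K₂, Classical.arbitrary K₂, fun h => absurd hxy h⟩
    · obtain ⟨p, q, h⟩ := exists_pairsCorrespond T hxy
      exact ⟨p, q, fun _ => h⟩
  choose P Q hPQ using hex
  have hQ : ∀ x y, x ≠ y → Q x y = P y x := fun x y h =>
    ((hPQ x y h).2.unique_right (hPQ y x h.symm).2.swap (hPQ x y h).1).2
  have hP : ∀ x y, x ≠ y → P x y ≠ P y x ∧ PairsCorrespond T x y (P x y) (P y x) := fun x y h =>
    hQ x y h ▸ hPQ x y h
  have choice : ∀ F : K₁ → K₁ → K₂, (∀ x y z, x ≠ y → x ≠ z → F x y = F x z) →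
      ∃ σ : K₁ → K₂, ∀ x y, x ≠ y → F x y = σ x := fun F hF => by
    have : ∀ x, ∃ p, ∀ y, x ≠ y → F x y = p := fun x => by
      by_cases hx : ∃ y, x ≠ y
      · obtain ⟨y, hy⟩ := hx
        exact ⟨F x y, fun z hz => hF x z y hz hy⟩
      · exact ⟨Classical.arbitrary K₂, fun y hy => absurd ⟨y, hy⟩ hx⟩
    choose σ hσ using this
    exact ⟨σ, hσ⟩
  rcases forall_eq_or_forall_eq_swap (P := P) (fun x y h => (hP x y h).1)
    (fun x y z hy hz => (hP x y hy).2.eq_or_eq (hP x z hz).2 (hP x y hy).1 (hP x z hz).1)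
    with h | h
  · obtain ⟨σ, hσ⟩ := choice P h
    exact ⟨T, σ, fun x y hxy => hσ x y hxy ▸ hσ y x hxy.symm ▸ hP x y hxy⟩
  · obtain ⟨σ, hσ⟩ := choice (fun x y => P y x) h
    refine ⟨T.trans (LinearIsometryEquiv.neg ℝ), σ, fun x y hxy => ?_⟩
    rw [← hσ x y hxy, ← hσ y x hxy.symm]
    exact ⟨(hP y x hxy.symm).1, (hP x y hxy).2.neg⟩

theorem nonempty_homeomorph_of_linearIsometryEquiv [T2Space K₁] [T2Space K₂] [Nonempty K₁]
    [Nonempty K₂] (T : ModConst K₁ ≃ₗᵢ[ℝ] ModConst K₂) : Nonempty (K₁ ≃ₜ K₂) := by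
  obtain ⟨S, σ, hσ⟩ := exists_forall_pairsCorrespond T
  have hinj : Function.Injective σ := fun x y h => by
    by_contra hxy
    exact (hσ x y hxy).1 h
  have hsurj : Function.Surjective σ := fun p => by
    -- A one-point K₂ has no pairs to pull back.
    by_cases hp : ∃ q, p ≠ q
    · obtain ⟨q, hpq⟩ := hp
      obtain ⟨x, y, hxy, h⟩ := exists_pairsCorrespond S.symm hpq
      exact ⟨x, ((hσ x y hxy).2.unique_right h.symm (hσ x y hxy).1).1⟩
    · push Not at hp
      exact ⟨Classical.arbitrary K₁, (hp _).symm⟩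
  have hcomp : ∀ g : C(K₂, ℝ), Continuous fun x => g (σ x) := fun g => by
    obtain ⟨f, hf⟩ := ModConst.mk_surjective (S.symm (ModConst.mk g))
    have hfg : S (ModConst.mk f) = ModConst.mk g := by rw [hf, S.apply_symm_apply]
    let a := Classical.arbitrary K₁
    have heq : (fun x => g (σ x)) = fun x => f x - f a + g (σ a) := funext fun x => by
      by_cases hx : x = a
      · simp [hx]
      · linarith [(hσ x a hx).2 f g hfg]
    rw [heq]
    fun_prop
  have hcont : Continuous σ := continuous_iff_continuousAt.2 fun x => by
    refine Filter.tendsto_def.2 fun U hU => ?_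
    obtain ⟨V, hVU, hV, hxV⟩ := mem_nhds_iff.1 hU
    obtain ⟨g, hg0, hg1, -⟩ := exists_continuous_zero_one_of_isClosed hV.isClosed_compl
      (isClosed_singleton (x := σ x)) (by simpa using hxV)
    have hx : 0 < g (σ x) := by rw [hg1 rfl]; exact one_pos
    filter_upwards [(hcomp g).continuousAt.eventually (lt_mem_nhds hx)] with z hz
    by_contra hzU
    exact hz.ne' (hg0 fun hzV => hzU (hVU hzV))
  exact ⟨hcont.homeoOfEquivCompactToT2 (f := Equiv.ofBijective σ ⟨hinj, hsurj⟩)⟩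

end LinearIsometry

/-! ### Passing between isometries of ray spaces, linear isometries and homeomorphisms. -/

section Isometry

variable {K₁ K₂ : Type*} [TopologicalSpace K₁] [CompactSpace K₁] [Nonempty K₁]
  [TopologicalSpace K₂] [CompactSpace K₂] [Nonempty K₂]

/-- In logarithmic coordinates the factors 2 cancel; Mazur-Ulam, after a translation fixing 0, gives
linearity. -/
theorem nonempty_linearIsometryEquiv (e : ProjPosCone K₁ ≃ᵢ ProjPosCone K₂) :
    Nonempty (ModConst K₁ ≃ₗᵢ[ℝ] ModConst K₂) := by
  obtain ⟨L₁, h₁⟩ := exists_logEquiv K₁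
  obtain ⟨L₂, h₂⟩ := exists_logEquiv K₂
  refine ⟨(IsometryEquiv.mk (L₁.symm.trans (e.toEquiv.trans L₂))
    (Isometry.of_dist_eq fun v w => ?_)).toRealLinearIsometryEquiv⟩
  have h := e.dist_eq (L₁.symm v) (L₁.symm w)
  rw [h₁, h₂, L₁.apply_symm_apply, L₁.apply_symm_apply] at h
  exact mul_left_cancel₀ two_ne_zero h

/-- Composition with a homeomorphism as an isometry between the spaces of rays. -/
def ProjPosCone.congr (h : K₁ ≃ₜ K₂) : ProjPosCone K₁ ≃ᵢ ProjPosCone K₂ where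
  toEquiv := Quotient.congr
    { toFun := fun f => ⟨f.1.comp h.symm, fun x => f.2 _⟩
      invFun := fun f => ⟨f.1.comp h, fun x => f.2 _⟩
      left_inv := fun f => Subtype.ext (ContinuousMap.ext fun x => by simp)
      right_inv := fun f => Subtype.ext (ContinuousMap.ext fun x => by simp) }
    fun f g => exists_congr fun c => and_congr_right fun _ => by
      simp only [ContinuousMap.ext_iff]
      exact h.symm.surjective.forall
  isometry_toFun := by
    have hr : ∀ f g : C(K₁, ℝ),
        orderRatio (f.comp (h.symm : C(K₂, K₁))) (g.comp (h.symm : C(K₂, K₁))) =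
          orderRatio f g := fun f g => by
      refine congrArg sInf (Set.ext fun c => and_congr_right fun _ => ?_)
      exact (h.symm.surjective.forall (p := fun x => f x ≤ (c • g) x)).symm
    refine Isometry.of_dist_eq ?_
    rintro ⟨f⟩ ⟨g⟩
    exact congrArg Real.log (congrArg₂ (· * ·) (hr f.1 g.1) (hr g.1 f.1))

end Isometry

end

end HilbertGeometry

theorem mainTheorem8 {K₁ : Type*} {K₂ : Type*}
    [TopologicalSpace K₁] [CompactSpace K₁] [T2Space K₁] [Nonempty K₁]
    [TopologicalSpace K₂] [CompactSpace K₂] [T2Space K₂] [Nonempty K₂] :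
    Nonempty (HilbertGeometry.ProjPosCone K₁ ≃ᵢ HilbertGeometry.ProjPosCone K₂) ↔
      Nonempty (K₁ ≃ₜ K₂) := by
  constructor
  · rintro ⟨e⟩
    obtain ⟨T⟩ := HilbertGeometry.nonempty_linearIsometryEquiv e
    exact HilbertGeometry.nonempty_homeomorph_of_linearIsometryEquiv T
  · rintro ⟨h⟩
    exact ⟨HilbertGeometry.ProjPosCone.congr h⟩
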